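/- Let $G$ be an arbitrary (possibly infinite) undirected graph and let $A,B\subseteq V(G)$. Paths are finite; a ray is a one-way infinite path; an end of $G$ is an equivalence class of rays, where two rays are equivalent if for every finite $S\subseteq V(G)$ they have tails in the same component of $G-S$. For a finite $S\subseteq V(G)$, an end $\omega$ lives in the unique component of $G-S$ in which every ray of $\omega$ has a tail. A vertex $v$ (respectively an end $\omega$) can be separated from a set $X\subseteq V(G)$ by removing finitely many vertices if there is a finite set $S\subseteq V(G)$, with $v\notin S$ in the case of a vertex, such that the component of $G-S$ that contains $v$ (respectively in which $\omega$ lives) contains no vertex of $X$. The pair $(A,B)$ is well-separated if every vertex and every end of $G$ can be separated from at least one of $A$ and $B$ by removing finitely many vertices. A vertex-linkage from a set $X\subseteq V(G)$ to $B$ is a family $(P_x\mid x\in X)$ of pairwise vertex-disjoint paths in $G$ such that $P_x$ starts in $x$ and ends in a vertex of $B$. Suppose that $(A,B)$ is well-separated. Then there is a vertex-linkage from the whole of $A$ to $B$ if and only if for every finite subset $F$ of $A$ there is a vertex-linkage from $F$ to $B$. -/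

import Mathlib

namespace InfMenger

variable {V : Type*}

/-- A ray of `G`: a one-way infinite path, given by its sequence of (pairwise distinct)
vertices. -/
structure Ray (G : SimpleGraph V) where
  /-- the sequence of vertices of the ray -/
  vert : ℕ → V
  injective : Function.Injective vert
  adj : ∀ n, G.Adj (vert n) (vert (n + 1))

/-- The ray `R` has a tail in the vertex set `C`. -/
def Ray.HasTailIn {G : SimpleGraph V} (R : Ray G) (C : Set V) : Prop :=
  ∃ n, ∀ m, n ≤ m → R.vert m ∈ C

/-- Two rays are equivalent if for every finite vertex set `S` they have tails in the same
component of `G - S`. -/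
def Ray.Equivalent {G : SimpleGraph V} (R R' : Ray G) : Prop :=
  ∀ S : Finset V, ∃ C : G.ComponentCompl (S : Set V), R.HasTailIn C ∧ R'.HasTailIn C

theorem Ray.exists_component {G : SimpleGraph V} (R : Ray G) (S : Finset V) :
    ∃ C : G.ComponentCompl (S : Set V), R.HasTailIn C := by
  have hfin : (R.vert ⁻¹' (S : Set V)).Finite :=
    S.finite_toSet.preimage R.injective.injOn
  obtain ⟨N, hN⟩ := hfin.bddAbove
  have hout : ∀ m, N + 1 ≤ m → R.vert m ∉ (S : Set V) := by
    intro m hm hmem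
    have := hN (show m ∈ R.vert ⁻¹' (S : Set V) from hmem)
    omega
  refine ⟨G.componentComplMk (hout (N + 1) le_rfl), N + 1, ?_⟩
  intro m hm
  induction m, hm using Nat.le_induction with
  | base => exact G.componentComplMk_mem _
  | succ k hk ih =>
    exact SimpleGraph.ComponentCompl.mem_of_adj _ _ ih (hout (k + 1) (by omega)) (R.adj k)

theorem Ray.component_unique {G : SimpleGraph V} (R : Ray G) {S : Finset V}
    {C D : G.ComponentCompl (S : Set V)} (hC : R.HasTailIn C) (hD : R.HasTailIn D) : C = D := by
  obtain ⟨n, hn⟩ := hC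
  obtain ⟨k, hk⟩ := hD
  by_contra hne
  exact Set.disjoint_left.mp (SimpleGraph.ComponentCompl.pairwise_disjoint hne)
    (hn (max n k) (le_max_left _ _)) (hk (max n k) (le_max_right _ _))

theorem Ray.equivalent_equivalence (G : SimpleGraph V) :
    Equivalence (Ray.Equivalent (G := G)) where
  refl R S := by
    obtain ⟨C, hC⟩ := R.exists_component S
    exact ⟨C, hC, hC⟩
  symm h S := by
    obtain ⟨C, h₁, h₂⟩ := h S
    exact ⟨C, h₂, h₁⟩
  trans {R R' R''} h h' S := by
    obtain ⟨C, h₁, h₂⟩ := h S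
    obtain ⟨D, h₃, h₄⟩ := h' S
    have hCD : C = D := R'.component_unique h₂ h₃
    subst hCD
    exact ⟨C, h₁, h₄⟩

/-- The equivalence of rays, as a setoid. -/
def raySetoid (G : SimpleGraph V) : Setoid (Ray G) :=
  ⟨Ray.Equivalent, Ray.equivalent_equivalence G⟩

/-- The ends of `G`: the equivalence classes of its rays. -/
def GraphEnd (G : SimpleGraph V) : Type _ :=
  Quotient (raySetoid G)

/-- The end `ω` lives in the vertex set `C`: every ray of `ω` has a tail in `C`. -/
def GraphEnd.LivesIn {G : SimpleGraph V} (ω : GraphEnd G) (C : Set V) : Prop :=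
  ∀ R : Ray G, Quotient.mk (raySetoid G) R = ω → R.HasTailIn C

/-- The end `ω` can be separated from `X` by removing finitely many vertices: for some finite
vertex set `S`, the component of `G - S` in which `ω` lives contains no vertex of `X`. -/
def EndSeparable (G : SimpleGraph V) (ω : GraphEnd G) (X : Set V) : Prop :=
  ∃ (S : Finset V) (C : G.ComponentCompl (S : Set V)),
    ω.LivesIn C ∧ Disjoint (C : Set V) X

/-- The vertex `v` can be separated from `X` by removing finitely many vertices (other than `v`
itself): for some finite vertex set `S` not containing `v`, the component of `G - S` containing
`v` contains no vertex of `X`. -/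
def VertexSeparable (G : SimpleGraph V) (v : V) (X : Set V) : Prop :=
  ∃ (S : Finset V) (hv : v ∉ (S : Set V)),
    Disjoint (G.componentComplMk hv : Set V) X

/-- The pair `(A, B)` is well-separated: every vertex and every end can be separated from one of
`A` or `B` by removing finitely many vertices. -/
def WellSeparated (G : SimpleGraph V) (A B : Set V) : Prop :=
  (∀ v : V, VertexSeparable G v A ∨ VertexSeparable G v B) ∧
    ∀ ω : GraphEnd G, EndSeparable G ω A ∨ EndSeparable G ω B

/-- There is a vertex-linkage from (the whole of) `A` to `B`: a family of pairwise
vertex-disjoint finite paths `(P a | a ∈ A)` of `G` such that `P a` starts in `a` and ends in a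
vertex of `B`. -/
def HasVertexLinkage (G : SimpleGraph V) (A B : Set V) : Prop :=
  ∃ (t : A → V) (P : ∀ a : A, G.Path (a : V) (t a)),
    (∀ a, t a ∈ B) ∧
      ∀ a a' : A, a ≠ a' →
        ∀ x : V, x ∈ (P a : G.Walk (a : V) (t a)).support →
          x ∉ (P a' : G.Walk (a' : V) (t a')).support

end InfMenger

namespace InfMenger

open SimpleGraph

variable {V : Type*} {G : SimpleGraph V}

/-! Well-separation forces every connected component of `G` to contain only finitely many vertices
of `A` (`WellSeparated.finite_reachable`). The hypothesis on finite sets then links each component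
separately, and paths in different components are disjoint. For the finiteness, infinitely many
vertices of `A` in one component would accumulate at a vertex or an end
(`exists_vertex_or_ray_of_infinite`), which is thus not separable from `A`. Nor is it separable from
`B`: a component of `G - S` avoiding `B` holds finitely many vertices of `A`, as their linking paths
leave it through distinct vertices of `S` (`finite_inter_of_disjoint`). -/

theorem HasVertexLinkage.mono {A F B : Set V} (h : HasVertexLinkage G A B) (hF : F ⊆ A) :
    HasVertexLinkage G F B := by
  obtain ⟨t, P, ht, hP⟩ := h
  refine ⟨fun a => t ⟨a, hF a.2⟩, fun a => P ⟨a, hF a.2⟩, fun a => ht _, fun a a' hne => ?_⟩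
  refine hP ⟨a, hF a.2⟩ ⟨a', hF a'.2⟩ fun h => hne (Subtype.ext ?_)
  exact congrArg (fun x : A => (x : V)) h

theorem mem_componentCompl_of_walk {S : Set V} (C : G.ComponentCompl S) {v u : V}
    (p : G.Walk v u) (hv : v ∈ C) (hp : ∀ x ∈ p.support, x ∉ S) : u ∈ C := by
  induction p with
  | nil => exact hv
  | cons h q ih =>
    refine ih (ComponentCompl.mem_of_adj _ _ hv (hp _ ?_) h) fun x hx => hp x ?_
    · simp
    · simp [hx]

/-- If all finite subsets of `A` can be linked to `B`, then a component of `G - S`, `S` finite,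
which avoids `B` contains only finitely many vertices of `A`. -/
theorem finite_inter_of_disjoint {A B : Set V}
    (hlink : ∀ F : Set V, F ⊆ A → F.Finite → HasVertexLinkage G F B) (S : Finset V)
    (C : G.ComponentCompl (S : Set V)) (hC : Disjoint (C : Set V) B) :
    (A ∩ (C : Set V)).Finite := by
  by_contra hinf
  obtain ⟨F, hF, hcard⟩ := Set.Infinite.exists_subset_card_eq hinf (S.card + 1)
  obtain ⟨t, P, ht, hP⟩ := hlink F (fun x hx => (hF hx).1) F.finite_toSet
  have hmeet : ∀ a : (F : Set V), ∃ s ∈ S, s ∈ (P a : G.Walk (a : V) (t a)).support := by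
    intro a
    by_contra! hno
    exact Set.disjoint_left.mp hC
      (mem_componentCompl_of_walk C (P a : G.Walk (a : V) (t a)) (hF a.2).2
        fun x hx hxS => hno x hxS hx) (ht a)
  choose s hsS hs using hmeet
  have hinj : Function.Injective fun a : (F : Set V) => (⟨s a, hsS a⟩ : S) := by
    intro a a' h
    by_contra hne
    have h' : s a = s a' := congrArg Subtype.val h
    exact hP a a' hne (s a) (hs a) (h' ▸ hs a')
  have := Fintype.card_le_of_injective _ hinj
  simp [hcard] at this

/-- The vertex `v` lies on a shortest path from `r` to `u`. -/
def OnGeodesic (G : SimpleGraph V) (r v u : V) : Prop :=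
  G.Reachable r v ∧ ∃ p : G.Walk v u, G.dist r v + p.length = G.dist r u

theorem dist_le_add_length {r v u : V} (h : G.Reachable r v) (p : G.Walk v u) :
    G.dist r u ≤ G.dist r v + p.length := by
  obtain ⟨q, hq⟩ := h.exists_walk_length_eq_dist
  rw [← hq, ← Walk.length_append]
  exact dist_le _

theorem OnGeodesic.trans {r v w u : V} (h : OnGeodesic G r v w) (h' : OnGeodesic G r w u) :
    OnGeodesic G r v u := by
  obtain ⟨hv, p, hp⟩ := h
  obtain ⟨-, q, hq⟩ := h'
  exact ⟨hv, p.append q, by rw [Walk.length_append]; omega⟩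

/-- Cutting `p` at `s` gives two triangle inequalities whose sum is tight, so each is tight. -/
theorem onGeodesic_of_mem_support {r v u s : V} (hv : G.Reachable r v) (p : G.Walk v u)
    (hp : G.dist r v + p.length = G.dist r u) (hs : s ∈ p.support) :
    OnGeodesic G r v s ∧ OnGeodesic G r s u := by
  classical
  have hlen := congrArg Walk.length (p.take_spec hs)
  rw [Walk.length_append] at hlen
  have hrs : G.Reachable r s := hv.trans ⟨p.takeUntil s hs⟩
  have h1 := dist_le_add_length hv (p.takeUntil s hs)
  have h2 := dist_le_add_length hrs (p.dropUntil s hs)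
  exact ⟨⟨hv, p.takeUntil s hs, by omega⟩, hrs, p.dropUntil s hs, by omega⟩

theorem OnGeodesic.dist_le {r v u : V} (h : OnGeodesic G r v u) : G.dist r v ≤ G.dist r u := by
  obtain ⟨-, p, hp⟩ := h
  omega

theorem OnGeodesic.exists_adj {r v u : V} (h : OnGeodesic G r v u) (hne : v ≠ u) :
    ∃ w, G.Adj v w ∧ G.dist r w = G.dist r v + 1 ∧ OnGeodesic G r w u := by
  obtain ⟨hv, p, hp⟩ := h
  cases p with
  | nil => exact absurd rfl hne
  | @cons _ w _ hadj q =>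
    have hrw : G.Reachable r w := hv.trans hadj.reachable
    have h1 := dist_le_add_length hv hadj.toWalk
    have h2 := dist_le_add_length hrw q
    simp only [Walk.length_cons, Walk.length_nil] at hp h1
    exact ⟨w, hadj, by omega, hrw, q, by omega⟩

/-- A form of the star-comb lemma: an infinite set `U` of vertices in a connected component has
infinitely many vertices close to some vertex or to some ray. -/
theorem exists_vertex_or_ray_of_infinite {U : Set V} {r : V} (hU : U.Infinite)
    (hr : ∀ u ∈ U, G.Reachable r u) :
    (∃ v, ∀ (S : Finset V) (hv : v ∉ (S : Set V)),
        (U ∩ (G.componentComplMk hv : Set V)).Infinite) ∨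
      ∃ R : Ray G, ∀ (S : Finset V) (C : G.ComponentCompl (S : Set V)), R.HasTailIn C →
        (U ∩ (C : Set V)).Infinite := by
  set Big : V → Prop := fun v => (U ∩ {u | OnGeodesic G r v u}).Infinite with hBig
  have hroot : Big r := by
    refine hU.mono fun u hu => ⟨hu, Reachable.refl r, ?_⟩
    obtain ⟨p, hp⟩ := (hr u hu).exists_walk_length_eq_dist
    exact ⟨p, by simp [hp]⟩
  -- Either big vertices can be followed away from `r` forever, giving a ray, or some big vertex has
  -- no big successor and is itself the accumulation vertex. Degrees may be infinite, so both cases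
  -- occur.
  by_cases hstep : ∀ v, Big v → ∃ w, G.Adj v w ∧ G.dist r w = G.dist r v + 1 ∧ Big w
  · right
    choose! next hadj hdist hbig using hstep
    let f : ℕ → V := fun n => next^[n] r
    have hf : ∀ n, f (n + 1) = next (f n) := fun n => Function.iterate_succ_apply' next n r
    have hfbig : ∀ n, Big (f n) := by
      intro n
      induction n with
      | zero => exact hroot
      | succ n ih => rw [hf]; exact hbig _ ih
    have hfdist : ∀ n, G.dist r (f n) = n := by
      intro n
      induction n with
      | zero => simp [f]
      | succ n ih => rw [hf, hdist _ (hfbig n), ih]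
    refine ⟨⟨f, fun m n h => ?_, fun n => ?_⟩, fun S C hC => ?_⟩
    · rw [← hfdist m, ← hfdist n, h]
    · rw [hf]; exact hadj _ (hfbig n)
    · obtain ⟨n, hn⟩ := hC
      -- Geodesics continuing beyond `f m` stay at distance at least `m` from `r`, hence miss `S`.
      let m := max n (S.sup (G.dist r) + 1)
      refine (hfbig m).mono fun u hu => ⟨hu.1, ?_⟩
      obtain ⟨hv, p, hp⟩ := hu.2
      refine mem_componentCompl_of_walk C p (hn m (le_max_left _ _)) fun x hx hxS => ?_
      have h1 := (onGeodesic_of_mem_support hv p hp hx).1.dist_le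
      have h2 : G.dist r x ≤ S.sup (G.dist r) := Finset.le_sup (f := G.dist r) hxS
      have h3 : S.sup (G.dist r) + 1 ≤ m := le_max_right _ _
      rw [hfdist] at h1
      omega
  · left
    push Not at hstep
    obtain ⟨v, hv, hno⟩ := hstep
    refine ⟨v, fun S hvS => ?_⟩
    -- A geodesic from `v` to `s` starts with a successor of `v`, which is not big; all of `U`
    -- beyond `s` is also beyond that successor.
    have hsmall : ∀ s ∈ S, OnGeodesic G r v s → (U ∩ {u | OnGeodesic G r s u}).Finite := by
      intro s hs hvs
      obtain ⟨w, hvw, hw, hws⟩ := hvs.exists_adj fun h => hvS (h ▸ hs)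
      exact (Set.not_infinite.mp (hno w hvw hw)).subset fun u hu => ⟨hu.1, hws.trans hu.2⟩
    have hfin : (⋃ s ∈ {s | s ∈ S ∧ OnGeodesic G r v s},
        U ∩ {u | OnGeodesic G r s u}).Finite :=
      (S.finite_toSet.subset fun s hs => hs.1).biUnion fun s hs => hsmall s hs.1 hs.2
    refine (Set.Infinite.sdiff hv hfin).mono fun u hu => ⟨hu.1.1, ?_⟩
    obtain ⟨hrv, p, hp⟩ := hu.1.2
    refine mem_componentCompl_of_walk _ p (G.componentComplMk_mem hvS) fun x hx hxS => hu.2 ?_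
    obtain ⟨h1, h2⟩ := onGeodesic_of_mem_support hrv p hp hx
    exact Set.mem_biUnion (show x ∈ {s | s ∈ S ∧ OnGeodesic G r v s} from ⟨hxS, h1⟩)
      ⟨hu.1.1, h2⟩

/-- If `(A, B)` is well-separated and all finite subsets of `A` can be linked to `B`, then every
connected component of `G` contains only finitely many vertices of `A`. -/
theorem WellSeparated.finite_reachable {A B : Set V} (hAB : WellSeparated G A B)
    (hlink : ∀ F : Set V, F ⊆ A → F.Finite → HasVertexLinkage G F B) (r : V) :
    {a | a ∈ A ∧ G.Reachable r a}.Finite := by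
  by_contra hinf
  have hsub : ∀ C : Set V, ({a | a ∈ A ∧ G.Reachable r a} ∩ C).Infinite → (A ∩ C).Infinite :=
    fun C h => h.mono fun u hu => ⟨hu.1.1, hu.2⟩
  have hnear : ∀ (S : Finset V) (C : G.ComponentCompl (S : Set V)), (A ∩ (C : Set V)).Infinite →
      ¬ Disjoint (C : Set V) A ∧ ¬ Disjoint (C : Set V) B := by
    refine fun S C h => ⟨fun hd => ?_, fun hd => h (finite_inter_of_disjoint hlink S C hd)⟩
    obtain ⟨x, hxA, hxC⟩ := h.nonempty
    exact Set.disjoint_left.mp hd hxC hxA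
  rcases exists_vertex_or_ray_of_infinite (G := G) hinf fun u hu => hu.2 with ⟨v, hv⟩ | ⟨R, hR⟩
  · rcases hAB.1 v with ⟨S, hvS, hd⟩ | ⟨S, hvS, hd⟩
    · exact (hnear S _ (hsub _ (hv S hvS))).1 hd
    · exact (hnear S _ (hsub _ (hv S hvS))).2 hd
  · rcases hAB.2 (Quotient.mk (raySetoid G) R) with ⟨S, C, hC, hd⟩ | ⟨S, C, hC, hd⟩
    · exact (hnear S C (hsub _ (hR S C (hC R rfl)))).1 hd
    · exact (hnear S C (hsub _ (hR S C (hC R rfl)))).2 hd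

/-- Linkages in the connected components of `G` combine to a linkage in `G`. -/
theorem hasVertexLinkage_of_components {A B : Set V}
    (h : ∀ c : G.ConnectedComponent,
      HasVertexLinkage G {a | a ∈ A ∧ G.connectedComponentMk a = c} B) :
    HasVertexLinkage G A B := by
  choose t P ht hP using h
  refine ⟨fun a => t (G.connectedComponentMk a) ⟨a, a.2, rfl⟩,
    fun a => P (G.connectedComponentMk a) ⟨a, a.2, rfl⟩, fun a => ht _ _, ?_⟩
  rintro ⟨a, ha⟩ ⟨a', ha'⟩ hne x hx hx'
  have hcc : G.connectedComponentMk a = G.connectedComponentMk a' := by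
    classical
    exact ConnectedComponent.sound
      (Reachable.trans ⟨Walk.takeUntil _ x hx⟩ (Reachable.symm ⟨Walk.takeUntil _ x hx'⟩))
  -- The type of `P c` depends on `c`, so the components are generalized to variables before being
  -- identified.
  have key : ∀ (c c' : G.ConnectedComponent) (hc : G.connectedComponentMk a = c)
      (hc' : G.connectedComponentMk a' = c'), c = c' →
      x ∈ (P c ⟨a, ha, hc⟩).1.support →
      x ∈ (P c' ⟨a', ha', hc'⟩).1.support → False := by
    rintro c _ hc hc' rfl h1 h2
    refine hP c ⟨a, ha, hc⟩ ⟨a', ha', hc'⟩ (fun h => hne (Subtype.ext ?_)) x h1 h2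
    exact Subtype.mk.inj h
  exact key _ _ rfl rfl hcc hx hx'

end InfMenger

theorem corollary4p3 {V : Type*} (G : SimpleGraph V) (A B : Set V)
    (hAB : InfMenger.WellSeparated G A B) :
    InfMenger.HasVertexLinkage G A B ↔
      ∀ F : Set V, F ⊆ A → F.Finite → InfMenger.HasVertexLinkage G F B := by
  refine ⟨fun h F hF _ => h.mono hF, fun h => ?_⟩
  refine InfMenger.hasVertexLinkage_of_components fun c => h _ (fun a ha => ha.1) ?_
  induction c using SimpleGraph.ConnectedComponent.ind with
  | _ r =>
    refine (hAB.finite_reachable h r).subset fun a ha => ⟨ha.1, ?_⟩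
    exact (SimpleGraph.ConnectedComponent.exact ha.2).symm
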